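/- Setting. One object may be sold to one of $n\ge 2$ bidders. A value profile is a vector $v\in[0,\bar v]^n$, where $\bar v>0$. A (direct, deterministic) mechanism consists of measurable allocation functions $x_i:[0,\bar v]^n\to\{0,1\}$ with $\sum_i x_i\le 1$ and measurable transfers $t_i:[0,\bar v]^n\to\mathbb R$, $i=1,\dots,n$. Let $\mathcal M$ be the set of mechanisms that are dominant-strategy incentive compatible ($v_ix_i(v)-t_i(v)\ge v_ix_i(w,v_{-i})-t_i(w,v_{-i})$ for all $i$, $v$ and all $w\in[0,\bar v]$) and ex post individually rational ($v_ix_i(v)-t_i(v)\ge 0$ for all $i$, $v$). Let $\Delta(m,\bar v)$ be the set of Borel probability distributions $F$ on $[0,\bar v]^n$ with $\int v_i\,dF=m$ for every $i$ (all bidders have the same mean $m$), where $0<m<\bar v$. A mechanism solves the maxmin problem if it belongs to $\mathcal M$ and attains $$\sup_{M\in\mathcal M}\ \inf_{F\in\Delta(m,\bar v)}\ \int\sum_{i=1}^n t_i^M(v)\,dF(v).$$ A second-price auction with reserve $r\ge 0$ is a mechanism in which, with $p_i(v_{-i})=\max\{r,\max_{j\ne i}v_j\}$, one has $x_i(v)=1$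 if $v_i>p_i(v_{-i})$, $x_i(v)=0$ if $v_i<p_i(v_{-i})$, the object is sold whenever $\max_i v_i>r$, and $t_i(v)=p_i(v_{-i})x_i(v)$. Ties between highest bidders may be broken in any measurable way, and the object may or may not be sold when $\max_i v_i=r$. Statement. Let $0<m<\bar v$. For every $n\ge2$ and $r\ge 0$, a second-price auction with reserve $r$ (with any tie-breaking) solves the maxmin problem if and only if one of the following two cases holds: 1. $r=\bar v-\sqrt{\bar v(\bar v-m)}$ and $n<\dfrac{1}{1-\sqrt{1-m/\bar v}}$; 2. $r\in[0,\bar v/n]$ and $n\ge\dfrac{1}{1-\sqrt{1-m/\bar v}}$. In particular, for fixed $m$ and $\bar v$ there is $N$ such that for all $n\ge N$ the second-price auction without reserve ($r=0$) solves the maxmin problem. -/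

import Mathlib

open MeasureTheory
open scoped ENNReal

namespace RobustAuction

/-- Value profiles `v ∈ [0, v̄]ⁿ`, with the product (equivalently, Borel) σ-algebra. -/
abbrev Profile (n : ℕ) (vbar : ℝ) : Type := Fin n → Set.Icc (0 : ℝ) vbar

/-- A direct deterministic mechanism `(x, t)`: measurable allocation functions with values in
`{0, 1}`, at most one of which is `1` at each profile, and measurable real transfers. -/
structure Mechanism (n : ℕ) (vbar : ℝ) where
  alloc : Fin n → Profile n vbar → ℝ
  transfer : Fin n → Profile n vbar → ℝ
  measurable_alloc : ∀ i, Measurable (alloc i)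
  measurable_transfer : ∀ i, Measurable (transfer i)
  alloc_zero_or_one : ∀ i v, alloc i v = 0 ∨ alloc i v = 1
  alloc_sum_le_one : ∀ v, ∑ i, alloc i v ≤ 1

namespace Mechanism

variable {n : ℕ} {vbar : ℝ}

/-- Dominant-strategy incentive compatibility: whatever the others report, bidder `i` with value
`v i` cannot gain by reporting `w` instead of `v i`. -/
def IsDSIC (M : Mechanism n vbar) : Prop :=
  ∀ (i : Fin n) (v : Profile n vbar) (w : Set.Icc (0 : ℝ) vbar),
    (v i : ℝ) * M.alloc i (Function.update v i w) - M.transfer i (Function.update v i w)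
      ≤ (v i : ℝ) * M.alloc i v - M.transfer i v

/-- Ex post individual rationality. -/
def IsEPIR (M : Mechanism n vbar) : Prop :=
  ∀ (i : Fin n) (v : Profile n vbar), 0 ≤ (v i : ℝ) * M.alloc i v - M.transfer i v

/-- Ex post revenue at a profile. -/
def revenue (M : Mechanism n vbar) (v : Profile n vbar) : ℝ := ∑ i, M.transfer i v

/-- Expected revenue under `F`, as an extended real: the integral of the positive part minus the
integral of the negative part. For ex post individually rational mechanisms the revenue is at most
`v̄`, so this is the usual integral with values in `[-∞, v̄]`. -/
noncomputable def expectedRevenue (M : Mechanism n vbar) (F : Measure (Profile n vbar)) : EReal :=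
  ((∫⁻ v, ENNReal.ofReal (M.revenue v) ∂F : ℝ≥0∞) : EReal)
    - ((∫⁻ v, ENNReal.ofReal (-M.revenue v) ∂F : ℝ≥0∞) : EReal)

end Mechanism

/-- The set `𝓜` of dominant-strategy incentive compatible and ex post individually rational
deterministic mechanisms. -/
def exPostMechanisms (n : ℕ) (vbar : ℝ) : Set (Mechanism n vbar) :=
  {M | M.IsDSIC ∧ M.IsEPIR}

/-- The set `Δ(m, v̄)` of Borel probability distributions on `[0, v̄]ⁿ` whose `i`-th marginal
has mean `m i`. -/
def feasibleDistributions {n : ℕ} (m : Fin n → ℝ) (vbar : ℝ) : Set (Measure (Profile n vbar)) :=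
  {F | IsProbabilityMeasure F ∧ ∀ i, ∫ v, (v i : ℝ) ∂F = m i}

namespace Mechanism

variable {n : ℕ} {vbar : ℝ}

/-- The revenue guarantee: worst-case expected revenue over all feasible distributions. -/
noncomputable def guarantee (M : Mechanism n vbar) (m : Fin n → ℝ) : EReal :=
  ⨅ F ∈ feasibleDistributions m vbar, M.expectedRevenue F

/-- `M` solves the maxmin problem: it belongs to `𝓜` and its guarantee is the supremum of the
guarantees of the mechanisms in `𝓜`. -/
def SolvesMaxmin (M : Mechanism n vbar) (m : Fin n → ℝ) : Prop :=
  M ∈ exPostMechanisms n vbar ∧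
    M.guarantee m = ⨆ M' ∈ exPostMechanisms n vbar, Mechanism.guarantee M' m

end Mechanism

/-- The price faced by bidder `i` in a second-price auction with reserve `r`: the maximum of `r`
and of the values of all other bidders. -/
noncomputable def secondPrice {n : ℕ} {vbar : ℝ} (r : ℝ) (i : Fin n) (v : Profile n vbar) : ℝ :=
  (Finset.univ.erase i).fold max r (fun j => (v j : ℝ))

/-- `M` is a second-price auction with reserve `r`: bidder `i` wins above the price
`max (r, max_{j ≠ i} v j)` and loses below it, the object is sold whenever some value exceeds the
reserve, the winner pays that price, and losers pay nothing. How ties among the highest bidders are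
broken, and whether the object is sold when the highest value equals `r`, is left arbitrary. -/
structure IsSecondPriceAuction {n : ℕ} {vbar : ℝ} (M : Mechanism n vbar) (r : ℝ) : Prop where
  wins : ∀ i v, secondPrice r i v < (v i : ℝ) → M.alloc i v = 1
  loses : ∀ i v, (v i : ℝ) < secondPrice r i v → M.alloc i v = 0
  sold : ∀ v : Profile n vbar, (∃ i, r < (v i : ℝ)) → ∃ i, M.alloc i v = 1
  payment : ∀ i v, M.transfer i v = secondPrice r i v * M.alloc i v

end RobustAuction

/-!
By linear programming duality, a number `g` is below the guarantee of a mechanism exactly when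
revenue has an affine minorant `g + ∑ lᵢ (vᵢ - m)`: the supporting hyperplane, at the vector of
means, of the convex hull of the epigraph of revenue
(`RobustAuction.Mechanism.exists_affine_minorant`).

For a deterministic incentive compatible mechanism, such a minorant is nonpositive at the profile
`vᵢ = vbar lᵢ / (1 + lᵢ)` of critical values (`0` if `lᵢ < 0`). Either the object is unsold there, or
its buyer `j` pays at most `vⱼ`, still buys at the same price with value `vbar`, and the minorant
rises by exactly `vⱼ` meanwhile (`RobustAuction.affine_minorant_criticalValue_nonpos`). Hence
`g ≤ ∑ lᵢ (m - vbar lᵢ / (1 + lᵢ))`, a sum of concave one-bidder terms. With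
`s = √(vbar (vbar - m))`, each term is maximized only at `lᵢ = (vbar - s) / s`, whose critical value
is `vbar - s`. This gives the bound for few bidders. When `n (vbar - s) ≥ vbar`, the constraint that
revenue is at most `vbar` at the highest profile matters as well, and together with the tangent of
the one-bidder term at the slope `1 / (n - 1)` it gives the bound `(n m - vbar) / (n - 1)`.

Second-price auctions with the stated reserves attain these bounds, as revenue then dominates the
affine function with these slopes. For any other reserve, the minorant that an optimal mechanism
must have is violated: at a constant profile just below the reserve, where the object is unsold, if
the reserve is too high; at a profile with one value `vbar` and all others slightly above the
reserve, if it is too low.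
-/

namespace RobustAuction

variable {n : ℕ} {vbar : ℝ}

/-! ### Expected revenue and affine minorants -/

namespace Mechanism

lemma measurable_revenue (M : Mechanism n vbar) : Measurable M.revenue :=
  Finset.measurable_sum _ fun i _ => M.measurable_transfer i

lemma expectedRevenue_eq_integral (M : Mechanism n vbar) {F : Measure (Profile n vbar)}
    (h : Integrable M.revenue F) : M.expectedRevenue F = ((∫ v, M.revenue v ∂F : ℝ) : EReal) := by
  have hp : ∫⁻ v, ENNReal.ofReal (M.revenue v) ∂F ≠ ⊤ := h.lintegral_lt_top.ne
  have hn : ∫⁻ v, ENNReal.ofReal (-M.revenue v) ∂F ≠ ⊤ := h.neg.lintegral_lt_top.ne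
  rw [integral_eq_lintegral_pos_part_sub_lintegral_neg_part h, EReal.coe_sub,
    EReal.coe_ennreal_toReal hp, EReal.coe_ennreal_toReal hn]
  rfl

lemma transfer_le {M : Mechanism n vbar} (hM : M.IsEPIR) (i : Fin n) (v : Profile n vbar) :
    M.transfer i v ≤ (v i : ℝ) * M.alloc i v := by
  have := hM i v
  linarith

lemma alloc_nonneg (M : Mechanism n vbar) (i : Fin n) (v : Profile n vbar) : 0 ≤ M.alloc i v := by
  rcases M.alloc_zero_or_one i v with h | h <;> rw [h]
  exact zero_le_one

/-- At most one bidder obtains the object. -/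
lemma alloc_eq_zero_of_ne {M : Mechanism n vbar} {i j : Fin n} {v : Profile n vbar}
    (hj : M.alloc j v = 1) (hij : i ≠ j) : M.alloc i v = 0 := by
  rcases M.alloc_zero_or_one i v with h | h
  · exact h
  · have h1 : ∑ k ∈ {i, j}, M.alloc k v ≤ ∑ k, M.alloc k v :=
      Finset.sum_le_sum_of_subset_of_nonneg (Finset.subset_univ _)
        fun k _ _ => M.alloc_nonneg k v
    rw [Finset.sum_pair hij, h, hj] at h1
    linarith [M.alloc_sum_le_one v]

lemma revenue_nonpos_of_unsold {M : Mechanism n vbar} (hM : M.IsEPIR) {v : Profile n vbar}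
    (h : ∀ i, M.alloc i v = 0) : M.revenue v ≤ 0 :=
  Finset.sum_nonpos fun i _ => by simpa [h i] using transfer_le hM i v

lemma revenue_le_transfer {M : Mechanism n vbar} (hM : M.IsEPIR) {v : Profile n vbar}
    {j : Fin n} (hj : M.alloc j v = 1) : M.revenue v ≤ M.transfer j v := by
  rw [revenue, ← Finset.add_sum_erase _ _ (Finset.mem_univ j)]
  have : ∑ i ∈ Finset.univ.erase j, M.transfer i v ≤ 0 := Finset.sum_nonpos fun i hi => by
    simpa [alloc_eq_zero_of_ne hj (Finset.ne_of_mem_erase hi)] using transfer_le hM i v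
  linarith

lemma revenue_le_vbar (hv : 0 ≤ vbar) {M : Mechanism n vbar} (hM : M.IsEPIR)
    (v : Profile n vbar) : M.revenue v ≤ vbar := by
  by_cases h : ∃ j, M.alloc j v = 1
  · obtain ⟨j, hj⟩ := h
    have := transfer_le hM j v
    rw [hj, mul_one] at this
    exact (revenue_le_transfer hM hj).trans (this.trans (v j).2.2)
  · push Not at h
    exact (revenue_nonpos_of_unsold hM
      fun i => (M.alloc_zero_or_one i v).resolve_right (h i)).trans hv

/-- Finitely supported beliefs: a convex combination of profiles with the right mean bounds the
guarantee by the corresponding convex combination of revenues. -/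
lemma guarantee_le_sum {ι : Type*} (M : Mechanism n vbar) {m : Fin n → ℝ} (t : Finset ι)
    (w : ι → ℝ) (z : ι → Profile n vbar) (hw : ∀ k ∈ t, 0 ≤ w k) (hw1 : ∑ k ∈ t, w k = 1)
    (hz : ∀ i, ∑ k ∈ t, w k * (z k i : ℝ) = m i) :
    M.guarantee m ≤ ((∑ k ∈ t, w k * M.revenue (z k) : ℝ) : EReal) := by
  set F : Measure (Profile n vbar) := ∑ k ∈ t, ENNReal.ofReal (w k) • Measure.dirac (z k) with hF
  have hint : ∀ f : Profile n vbar → ℝ, ∀ k ∈ t,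
      Integrable f (ENNReal.ofReal (w k) • Measure.dirac (z k)) := fun f k _ =>
    (integrable_dirac (by simp)).smul_measure ENNReal.ofReal_ne_top
  have hI : ∀ f : Profile n vbar → ℝ, ∫ v, f v ∂F = ∑ k ∈ t, w k * f (z k) := by
    intro f
    rw [hF, integral_finsetSum_measure (hint f)]
    refine Finset.sum_congr rfl fun k hk => ?_
    rw [integral_smul_measure, integral_dirac, ENNReal.toReal_ofReal (hw k hk), smul_eq_mul]
  have hprob : IsProbabilityMeasure F := by
    constructor
    rw [hF, Measure.finsetSum_apply]
    simp only [Measure.smul_apply, measure_univ, smul_eq_mul, mul_one]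
    rw [← ENNReal.ofReal_sum_of_nonneg hw, hw1, ENNReal.ofReal_one]
  have hmem : F ∈ feasibleDistributions m vbar := ⟨hprob, fun i => by rw [hI]; exact hz i⟩
  have hrev : Integrable M.revenue F := integrable_finsetSum_measure.2 (hint _)
  refine (iInf₂_le F hmem).trans ?_
  rw [M.expectedRevenue_eq_integral hrev, hI]

/-- Strong duality: a real number below the revenue guarantee is attained by an affine minorant
of the revenue function. The minorant is a supporting hyperplane, at the vector of means, of the
convex hull of the epigraph of the revenue function. It is not vertical because the vector of means
is interior to the cube. -/
lemma exists_affine_minorant {M : Mechanism n vbar} (hM : M.IsEPIR) {m : Fin n → ℝ}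
    (hm : ∀ i, m i ∈ Set.Ioo 0 vbar) (hv : 0 ≤ vbar) {g : ℝ} (hg : (g : EReal) ≤ M.guarantee m) :
    ∃ l : Fin n → ℝ, ∀ v : Profile n vbar, g + ∑ i, l i * ((v i : ℝ) - m i) ≤ M.revenue v := by
  set E : Set ((Fin n → ℝ) × ℝ) :=
    {p | ∃ v : Profile n vbar, (fun i => (v i : ℝ)) = p.1 ∧ M.revenue v ≤ p.2}
  set S := convexHull ℝ E with hS
  have hconv : Convex ℝ S := convex_convexHull ℝ E
  have hle : ∀ y : ℝ, (m, y) ∈ S → g ≤ y := by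
    intro y hy
    rw [hS, convexHull_eq] at hy
    obtain ⟨ι, t, w, z, hw, hw1, hz, hc⟩ := hy
    rw [Finset.centerMass_eq_of_sum_1 _ _ hw1] at hc
    have hz' : ∀ k, ∃ v : Profile n vbar, k ∈ t →
        (fun i => (v i : ℝ)) = (z k).1 ∧ M.revenue v ≤ (z k).2 := by
      intro k
      by_cases hk : k ∈ t
      · obtain ⟨v, h⟩ := hz k hk
        exact ⟨v, fun _ => h⟩
      · exact ⟨fun _ => ⟨0, le_rfl, hv⟩, fun h => absurd h hk⟩
    choose u hu using hz'
    have h1 : ∀ i, ∑ k ∈ t, w k * (u k i : ℝ) = m i := by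
      intro i
      have := congrFun (congrArg Prod.fst hc) i
      simp only [Prod.fst_sum, Prod.smul_fst, Finset.sum_apply, Pi.smul_apply, smul_eq_mul] at this
      rw [← this]
      exact Finset.sum_congr rfl fun k hk => by rw [← (hu k hk).1]
    have h2 := hg.trans (M.guarantee_le_sum t w u hw hw1 h1)
    have h3 : ∑ k ∈ t, w k * (z k).2 = y := by
      have := congrArg Prod.snd hc
      simpa only [Prod.snd_sum, Prod.smul_snd, smul_eq_mul] using this
    rw [← h3]
    exact (EReal.coe_le_coe_iff.1 h2).trans
      (Finset.sum_le_sum fun k hk => mul_le_mul_of_nonneg_left (hu k hk).2 (hw k hk))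
  have hnot : (m, g) ∉ interior S := by
    intro h
    have hc : Continuous fun ε : ℝ => (m, g - ε) := by fun_prop
    have ho := (isOpen_interior (s := S)).preimage hc
    obtain ⟨ε, hε, hb⟩ := Metric.isOpen_iff.1 ho 0 (by simpa using h)
    have := hle _ (interior_subset (hb (show ε / 2 ∈ Metric.ball 0 ε by
      rw [Metric.mem_ball, Real.dist_eq, sub_zero, abs_of_pos (by linarith)]; linarith)))
    linarith
  have hbox : Set.pi Set.univ (fun _ : Fin n => Set.Ioo 0 vbar) ×ˢ Set.Ioi vbar ⊆ interior S := by
    refine interior_maximal ?_ ((isOpen_set_pi Set.finite_univ fun _ _ => isOpen_Ioo).prod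
      isOpen_Ioi)
    rintro ⟨x, y⟩ ⟨hx, hy⟩
    refine subset_convexHull ℝ E ⟨fun i => ⟨x i, Set.Ioo_subset_Icc_self (hx i trivial)⟩, rfl, ?_⟩
    exact (revenue_le_vbar hv hM _).trans (le_of_lt hy)
  have hmint : (m, max g vbar + 1) ∈ interior S :=
    hbox ⟨fun i _ => hm i, lt_of_le_of_lt (le_max_right g vbar) (lt_add_one _)⟩
  obtain ⟨f, hf⟩ := geometric_hahn_banach_open_point hconv.interior isOpen_interior hnot
  have hfS : ∀ a ∈ S, f a ≤ f (m, g) := by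
    intro a ha
    have hcl : a ∈ closure (interior S) := by
      rw [hconv.closure_interior_eq_closure_of_nonempty_interior ⟨_, hmint⟩]
      exact subset_closure ha
    exact closure_minimal (fun b hb => (hf b hb).le)
      (isClosed_le f.continuous continuous_const) hcl
  have hsplit : ∀ (x : Fin n → ℝ) (y : ℝ), f (x, y) = f (x, 0) + y * f (0, 1) := by
    intro x y
    have : (x, y) = (x, (0 : ℝ)) + y • ((0 : Fin n → ℝ), (1 : ℝ)) := by simp
    rw [this, map_add, map_smul, smul_eq_mul]
  set b := f (0, 1)
  have hbneg : b < 0 := by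
    have := hf _ hmint
    rw [hsplit m g, hsplit m (max g vbar + 1)] at this
    nlinarith [le_max_left g vbar]
  set L : (Fin n → ℝ) →ₗ[ℝ] ℝ := f.toLinearMap ∘ₗ LinearMap.inl ℝ (Fin n → ℝ) ℝ
  have hLf : ∀ x, L x = f (x, 0) := fun x => rfl
  refine ⟨fun i => L (fun j => if i = j then 1 else 0) / (-b), fun v => ?_⟩
  have h1 : f ((fun i => (v i : ℝ)), M.revenue v) ≤ f (m, g) :=
    hfS _ (subset_convexHull ℝ E ⟨v, rfl, le_rfl⟩)
  rw [hsplit m g, hsplit _ (M.revenue v), ← hLf, ← hLf] at h1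
  have h2 : ∑ i, L (fun j => if i = j then 1 else 0) / (-b) * ((v i : ℝ) - m i)
      = (L (fun i => (v i : ℝ)) - L m) / (-b) := by
    rw [← map_sub, L.pi_apply_eq_sum_univ ((fun i => (v i : ℝ)) - m), Finset.sum_div]
    refine Finset.sum_congr rfl fun i _ => ?_
    simp only [Pi.sub_apply, smul_eq_mul]
    ring
  rw [h2]
  have h3 : (L (fun i => (v i : ℝ)) - L m) / (-b) ≤ M.revenue v - g := by
    rw [div_le_iff₀ (by linarith)]
    linarith
  linarith

/-- Weak duality: an affine minorant of a nonnegative revenue function bounds the guarantee from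
below. -/
lemma le_guarantee_of_affine_minorant (hv : 0 ≤ vbar) {M : Mechanism n vbar} (hM : M.IsEPIR)
    {m : Fin n → ℝ} (h0 : ∀ v, 0 ≤ M.revenue v) {c : ℝ} {l : Fin n → ℝ}
    (h : ∀ v : Profile n vbar, c + ∑ i, l i * (v i : ℝ) ≤ M.revenue v) :
    ((c + ∑ i, l i * m i : ℝ) : EReal) ≤ M.guarantee m := by
  refine le_iInf₂ fun F hF => ?_
  have hprob := hF.1
  have hrev : Integrable M.revenue F :=
    Integrable.of_bound M.measurable_revenue.aestronglyMeasurable vbar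
      (Filter.Eventually.of_forall fun v => by
        rw [Real.norm_of_nonneg (h0 v)]; exact revenue_le_vbar hv hM v)
  have hcoord : ∀ i, Integrable (fun v : Profile n vbar => l i * (v i : ℝ)) F := fun i =>
    (Integrable.of_bound (measurable_pi_apply i).subtype_val.aestronglyMeasurable vbar
      (Filter.Eventually.of_forall fun v => by
        rw [Real.norm_of_nonneg (v i).2.1]; exact (v i).2.2)).const_mul _
  have hsum : Integrable (fun v : Profile n vbar => ∑ i, l i * (v i : ℝ)) F :=
    integrable_finsetSum _ fun i _ => hcoord i
  rw [M.expectedRevenue_eq_integral hrev, EReal.coe_le_coe_iff]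
  have h1 := integral_mono ((integrable_const c).add hsum) hrev h
  have h2 : ∫ v, (c + ∑ i, l i * (v i : ℝ)) ∂F = c + ∑ i, l i * m i := by
    rw [integral_add (integrable_const c) hsum, integral_finsetSum _ fun i _ => hcoord i]
    simp [integral_const_mul, hF.2]
  exact h2 ▸ h1

end Mechanism

/-! ### The bound for an arbitrary mechanism -/

/-- For `0 ≤ l`, the value `p` with `l * (vbar - p) = p`: an affine function of slope `l` gains
exactly `p` between `p` and `vbar`. For negative slopes it is `0`. -/
noncomputable def criticalValue (vbar l : ℝ) : ℝ := vbar * max l 0 / (1 + max l 0)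

lemma criticalValue_of_nonneg {l : ℝ} (hl : 0 ≤ l) :
    criticalValue vbar l = vbar * l / (1 + l) := by
  rw [criticalValue, max_eq_left hl]

lemma criticalValue_of_nonpos {l : ℝ} (hl : l ≤ 0) : criticalValue vbar l = 0 := by
  rw [criticalValue, max_eq_right hl, mul_zero, zero_div]

lemma criticalValue_nonneg (hv : 0 < vbar) (l : ℝ) : 0 ≤ criticalValue vbar l := by
  unfold criticalValue
  positivity

lemma criticalValue_lt (hv : 0 < vbar) (l : ℝ) : criticalValue vbar l < vbar := by
  have : 0 ≤ max l 0 := le_max_right _ _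
  rw [criticalValue, div_lt_iff₀ (by linarith)]
  linarith

lemma criticalValue_le_mul (hv : 0 < vbar) (l : ℝ) :
    0 ≤ l ∧ criticalValue vbar l = l * (vbar - criticalValue vbar l) ∨
      criticalValue vbar l = 0 := by
  rcases le_total 0 l with hl | hl
  · left
    refine ⟨hl, ?_⟩
    rw [criticalValue_of_nonneg hl]
    field_simp
    ring
  · exact Or.inr (criticalValue_of_nonpos hl)

/-- An affine minorant of the revenue of a mechanism in `𝓜` is nonpositive at the profile of
critical values of its slopes. If the object is unsold there, revenue is nonpositive. If it is sold
to bidder `j`, then by incentive compatibility `j` still buys, and pays no more, with value `vbar`;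
so a change of `v j` that raises the minorant by the critical value of `j` leaves revenue at most
this critical value. -/
lemma affine_minorant_criticalValue_nonpos (hv : 0 < vbar) {M : Mechanism n vbar}
    (hM : M ∈ exPostMechanisms n vbar) {c : ℝ} {l : Fin n → ℝ}
    (h : ∀ v : Profile n vbar, c + ∑ i, l i * (v i : ℝ) ≤ M.revenue v) :
    c + ∑ i, l i * criticalValue vbar (l i) ≤ 0 := by
  obtain ⟨hIC, hIR⟩ := hM
  set v : Profile n vbar := fun i =>
    ⟨criticalValue vbar (l i), criticalValue_nonneg hv _, (criticalValue_lt hv _).le⟩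
  have hval : ∀ i, (v i : ℝ) = criticalValue vbar (l i) := fun i => rfl
  have hv0 := h v
  simp only [hval] at hv0
  by_cases hsold : ∃ j, M.alloc j v = 1
  swap
  · push Not at hsold
    exact hv0.trans (Mechanism.revenue_nonpos_of_unsold hIR
      fun i => (M.alloc_zero_or_one i v).resolve_right (hsold i))
  obtain ⟨j, hj⟩ := hsold
  have htj := Mechanism.transfer_le hIR j v
  rw [hj, mul_one, hval] at htj
  rcases criticalValue_le_mul hv (l j) with ⟨-, hcrit⟩ | hcrit
  swap
  · rw [hcrit] at htj
    exact hv0.trans ((Mechanism.revenue_le_transfer hIR hj).trans htj)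
  set top : Set.Icc (0 : ℝ) vbar := ⟨vbar, hv.le, le_rfl⟩ with htop
  set v' : Profile n vbar := Function.update v j top with hv'
  have hv'j : (v' j : ℝ) = vbar := by simp [hv', htop]
  have hback : Function.update v' j (v j) = v := by simp [hv']
  have ic1 := hIC j v' (v j)
  have ic2 := hIC j v top
  rw [hback, hj, hv'j] at ic1
  rw [← hv', hj, hval] at ic2
  have hlt := criticalValue_lt hv (l j)
  have hwin : M.alloc j v' = 1 := by
    rcases M.alloc_zero_or_one j v' with h0 | h1
    · rw [h0] at ic1 ic2
      linarith
    · exact h1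
  rw [hwin] at ic1
  have hrev := (h v').trans (Mechanism.revenue_le_transfer hIR hwin)
  have hsum : ∑ i, l i * (v' i : ℝ)
      = ∑ i, l i * criticalValue vbar (l i) + l j * (vbar - criticalValue vbar (l j)) := by
    rw [← Finset.add_sum_erase _ _ (Finset.mem_univ j),
      ← Finset.add_sum_erase _ (fun i => l i * criticalValue vbar (l i)) (Finset.mem_univ j), hv'j]
    have : ∑ i ∈ Finset.univ.erase j, l i * (v' i : ℝ)
        = ∑ i ∈ Finset.univ.erase j, l i * criticalValue vbar (l i) :=
      Finset.sum_congr rfl fun i hi => by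
        rw [hv', Function.update_of_ne (Finset.ne_of_mem_erase hi)]
    rw [this]
    ring
  rw [hsum, ← hcrit] at hrev
  linarith

/-- The bound on the guarantee of a mechanism in `𝓜` in terms of the slopes of a supporting affine
minorant; it is a sum of one-bidder terms. -/
lemma le_sum_of_affine_minorant (hv : 0 < vbar) {M : Mechanism n vbar}
    (hM : M ∈ exPostMechanisms n vbar) {m g : ℝ} {l : Fin n → ℝ}
    (h : ∀ v : Profile n vbar, g + ∑ i, l i * ((v i : ℝ) - m) ≤ M.revenue v) :
    g ≤ ∑ i, l i * (m - criticalValue vbar (l i)) := by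
  have h1 := affine_minorant_criticalValue_nonpos hv hM (c := g - ∑ i, l i * m) (l := l)
    fun v => by
      have := h v
      simp only [mul_sub, Finset.sum_sub_distrib] at this
      linarith
  simp only [mul_sub, Finset.sum_sub_distrib]
  linarith

/-- An affine minorant of the revenue is at most `vbar` at the highest profile. -/
lemma affine_minorant_top_le (hv : 0 ≤ vbar) {M : Mechanism n vbar} (hM : M.IsEPIR)
    {m g : ℝ} {l : Fin n → ℝ}
    (h : ∀ v : Profile n vbar, g + ∑ i, l i * ((v i : ℝ) - m) ≤ M.revenue v) :
    g + (∑ i, l i) * (vbar - m) ≤ vbar := by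
  have := (h fun _ => ⟨vbar, hv, le_rfl⟩).trans (Mechanism.revenue_le_vbar hv hM _)
  rwa [← Finset.sum_mul] at this

/-! ### One-bidder estimates -/

/-- With `s² = vbar (vbar - m)`, the one-bidder term is at most `(vbar - s)² / vbar`, by the
inequality `2 s ≤ vbar / μ + μ s² / vbar` for `μ = 1 + l`. -/
lemma slope_mul_le (hv : 0 < vbar) {m s : ℝ} (hm : 0 < m) (hs2 : s ^ 2 = vbar * (vbar - m))
    (l : ℝ) : l * (m - criticalValue vbar l) ≤ (vbar - s) ^ 2 / vbar := by
  rcases le_or_gt 0 l with hl | hl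
  · have hkey : (vbar - s) ^ 2 / vbar - l * (m - criticalValue vbar l)
        = (vbar - (1 + l) * s) ^ 2 / (vbar * (1 + l)) := by
      have hm' : m = vbar - s ^ 2 / vbar := by rw [hs2]; field_simp; ring
      rw [criticalValue_of_nonneg hl, hm']
      have : 1 + l ≠ 0 := by positivity
      field_simp
      ring
    have : 0 ≤ (vbar - (1 + l) * s) ^ 2 / (vbar * (1 + l)) := by positivity
    linarith
  · rw [criticalValue_of_nonpos hl.le, sub_zero]
    have : 0 ≤ (vbar - s) ^ 2 / vbar := by positivity
    nlinarith

/-- The slope `(vbar - s) / s` is the only maximizer of the one-bidder term. -/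
lemma slope_eq_of_le (hv : 0 < vbar) {m s : ℝ} (hm : 0 < m) (hs : 0 < s)
    (hs2 : s ^ 2 = vbar * (vbar - m)) {l : ℝ}
    (h : (vbar - s) ^ 2 / vbar ≤ l * (m - criticalValue vbar l)) : l = (vbar - s) / s := by
  rcases le_or_gt 0 l with hl | hl
  · have hkey : (vbar - s) ^ 2 / vbar - l * (m - criticalValue vbar l)
        = (vbar - (1 + l) * s) ^ 2 / (vbar * (1 + l)) := by
      have hm' : m = vbar - s ^ 2 / vbar := by rw [hs2]; field_simp; ring
      rw [criticalValue_of_nonneg hl, hm']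
      have : 1 + l ≠ 0 := by positivity
      field_simp
      ring
    have h1 : (vbar - (1 + l) * s) ^ 2 / (vbar * (1 + l)) = 0 :=
      le_antisymm (by linarith) (by positivity)
    have h2 : vbar - (1 + l) * s = 0 := by
      rcases div_eq_zero_iff.1 h1 with h2 | h2
      · exact pow_eq_zero_iff two_ne_zero |>.1 h2
      · exact absurd h2 (by positivity)
    rw [eq_div_iff hs.ne']
    linarith
  · rw [criticalValue_of_nonpos hl.le, sub_zero] at h
    have : 0 ≤ (vbar - s) ^ 2 / vbar := by positivity
    nlinarith

/-- The one-bidder term is a concave function of the slope; this is its tangent at the slope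
`1 / (N - 1)`, the slope of the minorant for `N` bidders in an auction without reserve. -/
lemma slope_mul_le_tangent (hv : 0 < vbar) {m N : ℝ} (hN : 1 < N) (l : ℝ) :
    l * (m - criticalValue vbar l) ≤ (N * m - vbar) / (N * (N - 1))
      + (m - vbar * (1 - ((N - 1) / N) ^ 2)) * (l - 1 / (N - 1)) := by
  have hN1 : 0 < N - 1 := by linarith
  have hN0 : 0 < N := by linarith
  rcases le_or_gt 0 l with hl | hl
  · have hkey : (N * m - vbar) / (N * (N - 1))
        + (m - vbar * (1 - ((N - 1) / N) ^ 2)) * (l - 1 / (N - 1))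
        - l * (m - criticalValue vbar l)
        = vbar * (((N - 1) * (1 + l) - N) / N) ^ 2 / (1 + l) := by
      rw [criticalValue_of_nonneg hl]
      have : 1 + l ≠ 0 := by positivity
      field_simp
      ring
    have : 0 ≤ vbar * (((N - 1) * (1 + l) - N) / N) ^ 2 / (1 + l) := by positivity
    linarith
  · rw [criticalValue_of_nonpos hl.le, sub_zero]
    have hkey : (N * m - vbar) / (N * (N - 1))
        + (m - vbar * (1 - ((N - 1) / N) ^ 2)) * (l - 1 / (N - 1)) - l * m
        = vbar * (1 / N) ^ 2 + vbar * (1 - ((N - 1) / N) ^ 2) * (-l) := by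
      field_simp
      ring
    have h1 : ((N - 1) / N) ^ 2 ≤ 1 :=
      pow_le_one₀ (by positivity) ((div_le_one hN0).2 (by linarith))
    have h2 : 0 ≤ vbar * (1 - ((N - 1) / N) ^ 2) * (-l) :=
      mul_nonneg (mul_nonneg hv.le (by linarith)) (by linarith)
    have h3 : 0 ≤ vbar * (1 / N) ^ 2 := by positivity
    linarith

/-! ### Upper bounds on the guarantee -/

/-- The sum of the one-bidder maxima bounds every affine minorant at the means; the bound is sharp
when `n * (vbar - s) < vbar`. -/
lemma le_few_bidders_value (hv : 0 < vbar) {M : Mechanism n vbar}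
    (hM : M ∈ exPostMechanisms n vbar) {m s g : ℝ} (hm : 0 < m)
    (hs2 : s ^ 2 = vbar * (vbar - m)) {l : Fin n → ℝ}
    (h : ∀ v : Profile n vbar, g + ∑ i, l i * ((v i : ℝ) - m) ≤ M.revenue v) :
    g ≤ n * ((vbar - s) ^ 2 / vbar) := by
  refine (le_sum_of_affine_minorant hv hM h).trans
    ((Finset.sum_le_sum fun i _ => slope_mul_le hv hm hs2 (l i)).trans_eq ?_)
  simp

/-- If the bound for few bidders is attained, every slope is the one-bidder maximizer. -/
lemma slope_eq_of_few_bidders_value_le (hv : 0 < vbar) {M : Mechanism n vbar}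
    (hM : M ∈ exPostMechanisms n vbar) {m s g : ℝ} (hm : 0 < m) (hs : 0 < s)
    (hs2 : s ^ 2 = vbar * (vbar - m)) {l : Fin n → ℝ}
    (h : ∀ v : Profile n vbar, g + ∑ i, l i * ((v i : ℝ) - m) ≤ M.revenue v)
    (hg : n * ((vbar - s) ^ 2 / vbar) ≤ g) (i : Fin n) : l i = (vbar - s) / s := by
  have h1 := le_sum_of_affine_minorant hv hM h
  have h2 : ∀ j ∈ Finset.univ, l j * (m - criticalValue vbar (l j)) ≤ (vbar - s) ^ 2 / vbar :=
    fun j _ => slope_mul_le hv hm hs2 (l j)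
  have h3 : ∑ j, l j * (m - criticalValue vbar (l j)) = ∑ _j : Fin n, (vbar - s) ^ 2 / vbar :=
    le_antisymm (Finset.sum_le_sum h2) (by simpa using hg.trans h1)
  exact slope_eq_of_le hv hm hs hs2
    ((Finset.sum_eq_sum_iff_of_le h2).1 h3 i (Finset.mem_univ i)).ge

/-- The bound for many bidders: the tangent bound has nonnegative slope in the sum of the slopes,
the bound at the highest profile has negative slope, and they agree when each slope is
`1 / (n - 1)`. -/
lemma le_many_bidders_value (hn : 2 ≤ n) (hv : 0 < vbar) {M : Mechanism n vbar}
    (hM : M ∈ exPostMechanisms n vbar) {m s g : ℝ} (hmv : m < vbar) (hs : 0 < s)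
    (hs2 : s ^ 2 = vbar * (vbar - m)) (hns : vbar ≤ n * (vbar - s)) {l : Fin n → ℝ}
    (h : ∀ v : Profile n vbar, g + ∑ i, l i * ((v i : ℝ) - m) ≤ M.revenue v) :
    g ≤ (n * m - vbar) / (n - 1) := by
  have hN : (2 : ℝ) ≤ n := by exact_mod_cast hn
  have hN1 : (0 : ℝ) < n - 1 := by linarith
  set d := m - vbar * (1 - (((n : ℝ) - 1) / n) ^ 2) with hd
  have hd0 : 0 ≤ d := by
    have h1 : s ≤ vbar * ((n - 1) / n) := by
      rw [← mul_div_assoc, le_div_iff₀ (by linarith)]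
      linarith
    have h2 : s ^ 2 ≤ (vbar * ((n - 1) / n)) ^ 2 := pow_le_pow_left₀ hs.le h1 2
    have h3 : vbar * (vbar - m) ≤ vbar * (vbar * (((n : ℝ) - 1) / n) ^ 2) := by
      rw [← hs2]; linarith
    have h4 := le_of_mul_le_mul_left h3 hv
    rw [hd]
    linarith
  have htop := affine_minorant_top_le hv.le hM.2 h
  have hsum := (le_sum_of_affine_minorant hv hM h).trans
    (Finset.sum_le_sum fun i _ => slope_mul_le_tangent hv (m := m) (N := n) (by linarith) (l i))
  rw [Finset.sum_add_distrib, ← Finset.mul_sum, Finset.sum_sub_distrib] at hsum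
  simp only [Finset.sum_const, Finset.card_univ, Fintype.card_fin, nsmul_eq_mul] at hsum
  rw [← hd] at hsum
  set x := ∑ i, l i - n * (1 / ((n : ℝ) - 1)) with hx
  have e1 : (n : ℝ) * ((n * m - vbar) / (n * (n - 1))) = (n * m - vbar) / (n - 1) := by
    field_simp
  have e2 : vbar - (∑ i, l i) * (vbar - m) = (n * m - vbar) / (n - 1) - (vbar - m) * x := by
    rw [hx]
    field_simp
    ring
  rw [e1] at hsum
  rcases le_total 0 x with h0 | h0
  · have : 0 ≤ (vbar - m) * x := mul_nonneg (by linarith) h0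
    linarith
  · have : d * x ≤ 0 := mul_nonpos_of_nonneg_of_nonpos hd0 h0
    linarith

/-- A bound on every affine minorant at the common mean bounds the guarantee. -/
lemma Mechanism.guarantee_le_of_forall_minorant {m : ℝ} (hm : 0 < m) (hmv : m < vbar)
    {M : Mechanism n vbar} (hM : M.IsEPIR) {G : ℝ}
    (h : ∀ (g : ℝ) (l : Fin n → ℝ),
      (∀ v : Profile n vbar, g + ∑ i, l i * ((v i : ℝ) - m) ≤ M.revenue v) → g ≤ G) :
    M.guarantee (fun _ => m) ≤ (G : EReal) := by
  by_contra! hlt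
  obtain ⟨g, hGg, hg⟩ := EReal.lt_iff_exists_real_btwn.1 hlt
  obtain ⟨l, hl⟩ := M.exists_affine_minorant hM (fun _ => ⟨hm, hmv⟩) (hm.trans hmv).le hg.le
  exact absurd (EReal.coe_lt_coe_iff.1 hGg) (not_lt.2 (h g l hl))

/-! ### Second-price auctions -/

lemma reserve_le_secondPrice (r : ℝ) (i : Fin n) (v : Profile n vbar) : r ≤ secondPrice r i v :=
  (Finset.le_fold_max _).2 (Or.inl le_rfl)

lemma value_le_secondPrice (r : ℝ) {i j : Fin n} (v : Profile n vbar) (hij : j ≠ i) :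
    (v j : ℝ) ≤ secondPrice r i v :=
  (Finset.le_fold_max _).2 (Or.inr ⟨j, by simpa using hij, le_rfl⟩)

lemma secondPrice_le {r c : ℝ} {i : Fin n} {v : Profile n vbar} (hr : r ≤ c)
    (h : ∀ j, j ≠ i → (v j : ℝ) ≤ c) : secondPrice r i v ≤ c :=
  (Finset.fold_max_le _).2 ⟨hr, fun j hj => h j (Finset.ne_of_mem_erase hj)⟩

/-- The price faced by a bidder does not depend on the bidder's own report. -/
lemma secondPrice_update (r : ℝ) (i : Fin n) (v : Profile n vbar) (w : Set.Icc (0 : ℝ) vbar) :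
    secondPrice r i (Function.update v i w) = secondPrice r i v :=
  Finset.fold_congr fun j hj => by rw [Function.update_of_ne (Finset.ne_of_mem_erase hj)]

lemma measurable_secondPrice (r : ℝ) (i : Fin n) :
    Measurable (fun v : Profile n vbar => secondPrice r i v) := by
  unfold secondPrice
  induction Finset.univ.erase i using Finset.induction_on with
  | empty => simp
  | insert a s ha ih =>
    simp only [Finset.fold_insert ha]
    exact Measurable.max (by fun_prop) ih

namespace IsSecondPriceAuction

variable {M : Mechanism n vbar} {r : ℝ}

lemma mem_exPostMechanisms (h : IsSecondPriceAuction M r) : M ∈ exPostMechanisms n vbar := by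
  constructor
  · intro i v w
    rw [h.payment, h.payment, secondPrice_update, ← sub_mul, ← sub_mul]
    have hx := M.alloc_zero_or_one i (Function.update v i w)
    rcases lt_trichotomy (v i : ℝ) (secondPrice r i v) with hlt | heq | hgt
    · rw [h.loses i v hlt, mul_zero]
      exact mul_nonpos_of_nonpos_of_nonneg (by linarith) (M.alloc_nonneg _ _)
    · rw [heq, sub_self, zero_mul, zero_mul]
    · rw [h.wins i v hgt]
      rcases hx with hx | hx <;> rw [hx]
      linarith
  · intro i v
    rw [h.payment, ← sub_mul]
    rcases lt_or_ge (v i : ℝ) (secondPrice r i v) with hlt | hge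
    · rw [h.loses i v hlt, mul_zero]
    · exact mul_nonneg (by linarith) (M.alloc_nonneg _ _)

lemma revenue_nonneg (h : IsSecondPriceAuction M r) (hr : 0 ≤ r) (v : Profile n vbar) :
    0 ≤ M.revenue v :=
  Finset.sum_nonneg fun i _ => by
    rw [h.payment]
    exact mul_nonneg (hr.trans (reserve_le_secondPrice r i v)) (M.alloc_nonneg i v)

/-- When some value exceeds the reserve, revenue is the price faced by one of the bidders. -/
lemma exists_revenue_eq (h : IsSecondPriceAuction M r) {v : Profile n vbar}
    (hv : ∃ i, r < (v i : ℝ)) : ∃ j, M.revenue v = secondPrice r j v := by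
  obtain ⟨j, hj⟩ := h.sold v hv
  refine ⟨j, ?_⟩
  rw [Mechanism.revenue, Finset.sum_eq_single j]
  · rw [h.payment, hj, mul_one]
  · intro i _ hij
    rw [h.payment, Mechanism.alloc_eq_zero_of_ne hj hij, mul_zero]
  · simp

lemma revenue_eq_zero_of_lt_reserve (h : IsSecondPriceAuction M r) {v : Profile n vbar}
    (hv : ∀ i, (v i : ℝ) < r) : M.revenue v = 0 :=
  Finset.sum_eq_zero fun i _ => by
    rw [h.payment, h.loses i v ((hv i).trans_le (reserve_le_secondPrice r i v)), mul_zero]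

/-- Above the reserve, the sum of the values is at most `vbar` plus `n - 1` times the revenue. -/
lemma sum_le_of_reserve_lt (h : IsSecondPriceAuction M r) {v : Profile n vbar}
    (hv : ∃ i, r < (v i : ℝ)) :
    r ≤ M.revenue v ∧ ∑ i, (v i : ℝ) ≤ vbar + (n - 1) * M.revenue v := by
  obtain ⟨j, hj⟩ := h.exists_revenue_eq hv
  refine ⟨hj ▸ reserve_le_secondPrice r j v, ?_⟩
  rw [← Finset.add_sum_erase _ _ (Finset.mem_univ j)]
  have h1 : ∑ i ∈ Finset.univ.erase j, (v i : ℝ)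
      ≤ ∑ _i ∈ Finset.univ.erase j, M.revenue v :=
    Finset.sum_le_sum fun i hi => hj ▸ value_le_secondPrice r v (Finset.ne_of_mem_erase hi)
  rw [Finset.sum_const, Finset.card_erase_of_mem (Finset.mem_univ j), Finset.card_univ,
    Fintype.card_fin, nsmul_eq_mul, Nat.cast_sub (by have := j.2; lia), Nat.cast_one] at h1
  linarith [(v j).2.2]

lemma few_bidders_value_le_guarantee (h : IsSecondPriceAuction M r) (hv : 0 < vbar)
    (hr : 0 ≤ r) (hrv : r < vbar) (hnr : n * r ≤ vbar) (m : ℝ) :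
    ((n * (r / (vbar - r) * (m - r)) : ℝ) : EReal) ≤ M.guarantee (fun _ => m) := by
  have hd : 0 < vbar - r := by linarith
  set a := r / (vbar - r) with ha
  have ha0 : 0 ≤ a := div_nonneg hr hd.le
  have har : a * (vbar - r) = r := div_mul_cancel₀ _ hd.ne'
  have key := Mechanism.le_guarantee_of_affine_minorant hv.le h.mem_exPostMechanisms.2
    (m := fun _ => m) (h.revenue_nonneg hr) (c := -(n * (a * r))) (l := fun _ => a) (by
      intro v
      rw [← Finset.mul_sum]
      by_cases hsold : ∃ i, r < (v i : ℝ)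
      · obtain ⟨h1, h2⟩ := h.sum_le_of_reserve_lt hsold
        have h3 := mul_le_mul_of_nonneg_left h2 ha0
        have h4 : a * (n - 1) ≤ 1 := by
          rw [ha, div_mul_eq_mul_div, div_le_one hd]
          linarith
        have h5 := mul_le_mul_of_nonneg_right h4 (sub_nonneg.2 h1)
        linarith
      · push Not at hsold
        have h1 : ∑ i, (v i : ℝ) ≤ n * r := by
          simpa using Finset.sum_le_sum fun i (_ : i ∈ Finset.univ) => hsold i
        have h2 := mul_le_mul_of_nonneg_left h1 ha0
        linarith [h.revenue_nonneg hr v])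
  refine le_of_eq_of_le (congrArg _ ?_) key
  simp
  ring

lemma many_bidders_value_le_guarantee (h : IsSecondPriceAuction M r) (hn : 2 ≤ n)
    (hv : 0 < vbar) (hr : 0 ≤ r) (hnr : n * r ≤ vbar) (m : ℝ) :
    (((n * m - vbar) / (n - 1) : ℝ) : EReal) ≤ M.guarantee (fun _ => m) := by
  have hN : (2 : ℝ) ≤ n := by exact_mod_cast hn
  have hN1 : (0 : ℝ) < n - 1 := by linarith
  have key := Mechanism.le_guarantee_of_affine_minorant hv.le h.mem_exPostMechanisms.2
    (m := fun _ => m) (h.revenue_nonneg hr) (c := -(vbar / (n - 1)))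
    (l := fun _ => 1 / (n - 1)) (by
      intro v
      rw [← Finset.mul_sum]
      have e : -(vbar / (n - 1)) + 1 / ((n : ℝ) - 1) * ∑ i, (v i : ℝ)
          = (∑ i, (v i : ℝ) - vbar) / (n - 1) := by ring
      rw [e, div_le_iff₀ hN1]
      by_cases hsold : ∃ i, r < (v i : ℝ)
      · linarith [(h.sum_le_of_reserve_lt hsold).2]
      · push Not at hsold
        have h1 : ∑ i, (v i : ℝ) ≤ n * r := by
          simpa using Finset.sum_le_sum fun i (_ : i ∈ Finset.univ) => hsold i
        have h2 := mul_nonneg (h.revenue_nonneg hr v) hN1.le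
        linarith)
  refine le_of_eq_of_le (congrArg _ ?_) key
  simp
  ring

/-- With a reserve below the critical value `vbar - s`, and few bidders, the minorant whose slopes
are all `(vbar - s) / s` exceeds revenue at a profile with one value `vbar` and all others between
the reserve and the critical value. -/
lemma le_reserve_of_minorant (h : IsSecondPriceAuction M r) (hn : 2 ≤ n) (hr : 0 ≤ r) {m s g : ℝ}
    (hs : 0 < s) (hns : n * (vbar - s) < vbar)
    (hg : g = n * ((vbar - s) / s * (m - (vbar - s))))
    (hl : ∀ v : Profile n vbar, g + ∑ i, (vbar - s) / s * ((v i : ℝ) - m) ≤ M.revenue v) :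
    vbar - s ≤ r := by
  by_contra! hlt
  obtain ⟨t, hrt, hts⟩ := exists_between hlt
  have hv : 0 < vbar := by linarith
  have ht : t ∈ Set.Icc 0 vbar := ⟨by linarith, by linarith⟩
  set j : Fin n := ⟨0, by lia⟩
  set v : Profile n vbar :=
    Function.update (fun _ => ⟨t, ht⟩) j ⟨vbar, hv.le, le_rfl⟩ with hvdef
  have hvj : (v j : ℝ) = vbar := by simp [hvdef]
  have hvi : ∀ i, i ≠ j → (v i : ℝ) = t := fun i hi => by simp [hvdef, hi]
  have hprice : secondPrice r j v ≤ t := secondPrice_le hrt.le fun i hi => (hvi i hi).le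
  have hrev : M.revenue v ≤ t := by
    have hwin := h.wins j v (by rw [hvj]; linarith)
    refine (Mechanism.revenue_le_transfer h.mem_exPostMechanisms.2 hwin).trans ?_
    rwa [h.payment, hwin, mul_one]
  have hsum : ∑ i, (v i : ℝ) = vbar + (n - 1) * t := by
    rw [← Finset.add_sum_erase _ _ (Finset.mem_univ j), hvj,
      Finset.sum_congr rfl fun i hi => hvi i (Finset.ne_of_mem_erase hi), Finset.sum_const,
      Finset.card_erase_of_mem (Finset.mem_univ j), Finset.card_univ, Fintype.card_fin,
      nsmul_eq_mul, Nat.cast_sub (by lia), Nat.cast_one]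
  have h1 := (hl v).trans hrev
  rw [← Finset.mul_sum, Finset.sum_sub_distrib, hsum, hg] at h1
  simp only [Finset.sum_const, Finset.card_univ, Fintype.card_fin, nsmul_eq_mul] at h1
  set a := (vbar - s) / s with ha
  have has : a * s = vbar - s := div_mul_cancel₀ _ hs.ne'
  have h2 : a * (n - 1) < 1 := by
    rw [ha, div_mul_eq_mul_div, div_lt_one hs]
    linarith
  have h3 := mul_pos (sub_pos.2 h2) (sub_pos.2 hts)
  nlinarith

/-- A minorant that is positive at the constant profiles just above `p` forces the reserve to be at
most `p`: below the reserve, revenue vanishes. -/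
lemma reserve_le_of_minorant (h : IsSecondPriceAuction M r) {m g p b : ℝ} {l : Fin n → ℝ}
    (hp : 0 ≤ p) (hpb : p < b) (hb : b ≤ vbar)
    (hl : ∀ v : Profile n vbar, g + ∑ i, l i * ((v i : ℝ) - m) ≤ M.revenue v)
    (hpos : ∀ t, p < t → t < b → 0 < g + (∑ i, l i) * (t - m)) : r ≤ p := by
  by_contra! hlt
  obtain ⟨t, hpt, htr⟩ := exists_between (lt_min hlt hpb)
  have h1 := hl fun _ => ⟨t, hp.trans hpt.le, (htr.le.trans (min_le_right _ _)).trans hb⟩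
  rw [h.revenue_eq_zero_of_lt_reserve fun _ => htr.trans_le (min_le_left _ _),
    ← Finset.sum_mul] at h1
  linarith [hpos t hpt (htr.trans_le (min_le_right _ _))]

end IsSecondPriceAuction

/-! ### Existence of a second-price auction -/

/-- In the tie-breaking rule used for existence, bidder `i` wins when `i` is the first among the
highest bidders and bids more than the reserve. -/
def IsFirstHighest (r : ℝ) (i : Fin n) (v : Profile n vbar) : Prop :=
  r < (v i : ℝ) ∧ ∀ j, (v j : ℝ) ≤ v i ∧ (j < i → (v j : ℝ) < v i)

lemma measurableSet_isFirstHighest (r : ℝ) (i : Fin n) :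
    MeasurableSet {v : Profile n vbar | IsFirstHighest r i v} := by
  have hm : ∀ j, Measurable fun v : Profile n vbar => (v j : ℝ) := fun j => by fun_prop
  simp only [IsFirstHighest, Set.ofPred_and, Set.ofPred_forall]
  refine (measurableSet_lt measurable_const (hm i)).inter (MeasurableSet.iInter fun j =>
    (measurableSet_le (hm j) (hm i)).inter (MeasurableSet.iInter fun _ =>
      measurableSet_lt (hm j) (hm i)))

lemma IsFirstHighest.eq {r : ℝ} {i j : Fin n} {v : Profile n vbar} (hi : IsFirstHighest r i v)
    (hj : IsFirstHighest r j v) : i = j := by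
  rcases lt_trichotomy i j with h | h | h
  · exact absurd ((hj.2 i).2 h) (not_lt.2 (hi.2 j).1)
  · exact h
  · exact absurd ((hi.2 j).2 h) (not_lt.2 (hj.2 i).1)

open Classical in
/-- The second-price auction with reserve `r` in which ties are won by the bidder of lowest index,
and the object is not sold when the highest value equals `r`. -/
noncomputable def secondPriceAuction (n : ℕ) (vbar r : ℝ) : Mechanism n vbar where
  alloc i v := if IsFirstHighest r i v then 1 else 0
  transfer i v := secondPrice r i v * if IsFirstHighest r i v then 1 else 0
  measurable_alloc i :=
    Measurable.ite (measurableSet_isFirstHighest r i) measurable_const measurable_const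
  measurable_transfer i := (measurable_secondPrice r i).mul
    (Measurable.ite (measurableSet_isFirstHighest r i) measurable_const measurable_const)
  alloc_zero_or_one i v := by
    split_ifs
    · exact Or.inr rfl
    · exact Or.inl rfl
  alloc_sum_le_one v := by
    rw [Finset.sum_boole]
    exact_mod_cast Finset.card_le_one.2 fun i hi j hj =>
      IsFirstHighest.eq (Finset.mem_filter.1 hi).2 (Finset.mem_filter.1 hj).2

lemma isSecondPriceAuction_secondPriceAuction (n : ℕ) (vbar r : ℝ) :
    IsSecondPriceAuction (secondPriceAuction n vbar r) r where
  wins i v h := by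
    have h1 : ∀ j, j ≠ i → (v j : ℝ) < v i := fun j hj => (value_le_secondPrice r v hj).trans_lt h
    refine if_pos ⟨(reserve_le_secondPrice r i v).trans_lt h, fun j => ⟨?_, fun hj => h1 j hj.ne⟩⟩
    rcases eq_or_ne j i with rfl | hj
    · exact le_rfl
    · exact (h1 j hj).le
  loses i v h := if_neg fun hw =>
    absurd h (not_lt.2 (secondPrice_le hw.1.le fun j _ => (hw.2 j).1))
  sold v h := by
    obtain ⟨k, hk⟩ := h
    have : Nonempty (Fin n) := ⟨k⟩
    obtain ⟨a, ha⟩ := Finite.exists_max fun i => (v i : ℝ)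
    -- the first maximizer
    obtain ⟨i, hi, hmin⟩ := WellFounded.has_min (wellFounded_lt (α := Fin n))
      {i | ∀ j, (v j : ℝ) ≤ v i} ⟨a, ha⟩
    refine ⟨i, if_pos ⟨hk.trans_le (hi k), fun j => ⟨hi j, fun hj => ?_⟩⟩⟩
    by_contra! hle
    exact hmin j (fun k => (hi k).trans hle) hj
  payment _ _ := rfl

/-! ### Characterization of the optimal reserves -/

/-- A bound on the guarantees of all mechanisms in `𝓜` that is attained by some mechanism
characterizes the solutions of the maxmin problem. -/
lemma Mechanism.solvesMaxmin_iff {m : Fin n → ℝ} {G : EReal} {M M₀ : Mechanism n vbar}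
    (hG : ∀ M' ∈ exPostMechanisms n vbar, M'.guarantee m ≤ G)
    (h₀ : M₀ ∈ exPostMechanisms n vbar) (hG₀ : G ≤ M₀.guarantee m)
    (hM : M ∈ exPostMechanisms n vbar) : M.SolvesMaxmin m ↔ G ≤ M.guarantee m := by
  have hsup : ⨆ M' ∈ exPostMechanisms n vbar, Mechanism.guarantee M' m = G :=
    le_antisymm (iSup₂_le hG) (hG₀.trans (le_iSup₂ (f := fun M' _ => Mechanism.guarantee M' m)
      M₀ h₀))
  rw [SolvesMaxmin, hsup]
  exact ⟨fun h => h.2.ge, fun h => ⟨hM, le_antisymm (hG M hM) h⟩⟩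

/-- For few bidders, only the one-bidder reserve `vbar - s` is optimal. -/
lemma IsSecondPriceAuction.solvesMaxmin_iff_of_few_bidders {M : Mechanism n vbar} {r m s : ℝ}
    (h : IsSecondPriceAuction M r) (hn : 2 ≤ n) (hr : 0 ≤ r) (hm : 0 < m) (hmv : m < vbar)
    (hs : 0 < s) (hsv : s < vbar) (hs2 : s ^ 2 = vbar * (vbar - m)) (hns : n * (vbar - s) < vbar) :
    M.SolvesMaxmin (fun _ => m) ↔ r = vbar - s := by
  have hv : 0 < vbar := hm.trans hmv
  have hN : (2 : ℝ) ≤ n := by exact_mod_cast hn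
  have hval : (n : ℝ) * ((vbar - s) / s * (m - (vbar - s))) = n * ((vbar - s) ^ 2 / vbar) := by
    have hm' : m = vbar - s ^ 2 / vbar := by rw [hs2]; field_simp; ring
    rw [hm']
    field_simp
    ring
  have hattain : ∀ M' : Mechanism n vbar, IsSecondPriceAuction M' (vbar - s) →
      ((n * ((vbar - s) ^ 2 / vbar) : ℝ) : EReal) ≤ M'.guarantee (fun _ => m) := by
    intro M' h'
    have := h'.few_bidders_value_le_guarantee hv (by linarith) (by linarith) hns.le m
    rwa [sub_sub_cancel, hval] at this
  rw [Mechanism.solvesMaxmin_iff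
    (fun M' hM' => M'.guarantee_le_of_forall_minorant hm hmv hM'.2
      fun g l hl => le_few_bidders_value hv hM' hm hs2 hl)
    (isSecondPriceAuction_secondPriceAuction n vbar _).mem_exPostMechanisms
    (hattain _ (isSecondPriceAuction_secondPriceAuction n vbar _)) h.mem_exPostMechanisms]
  refine ⟨fun hg => ?_, fun hrs => hattain M (hrs ▸ h)⟩
  obtain ⟨l, hl⟩ := M.exists_affine_minorant h.mem_exPostMechanisms.2 (fun _ => ⟨hm, hmv⟩) hv.le hg
  have hslope := slope_eq_of_few_bidders_value_le hv h.mem_exPostMechanisms hm hs hs2 hl le_rfl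
  refine le_antisymm ?_ (h.le_reserve_of_minorant hn hr hs hns hval.symm
    (by simpa only [hslope] using hl))
  refine h.reserve_le_of_minorant (by linarith) (by linarith : vbar - s < vbar) le_rfl hl ?_
  intro t ht _
  have e : (∑ i, l i) = n * ((vbar - s) / s) := by simp [hslope]
  rw [e, ← hval]
  have : 0 < n * ((vbar - s) / s) * (t - (vbar - s)) :=
    mul_pos (mul_pos (by linarith) (div_pos (by linarith) hs)) (by linarith)
  linarith

/-- For many bidders, exactly the reserves up to `vbar / n` are optimal. -/
lemma IsSecondPriceAuction.solvesMaxmin_iff_of_many_bidders {M : Mechanism n vbar} {r m s : ℝ}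
    (h : IsSecondPriceAuction M r) (hn : 2 ≤ n) (hr : 0 ≤ r) (hm : 0 < m) (hmv : m < vbar)
    (hs : 0 < s) (hs2 : s ^ 2 = vbar * (vbar - m)) (hns : vbar ≤ n * (vbar - s)) :
    M.SolvesMaxmin (fun _ => m) ↔ r ≤ vbar / n := by
  have hv : 0 < vbar := hm.trans hmv
  have hN : (2 : ℝ) ≤ n := by exact_mod_cast hn
  have hN0 : (0 : ℝ) < n := by linarith
  have hN1 : (0 : ℝ) < n - 1 := by linarith
  rw [Mechanism.solvesMaxmin_iff
    (fun M' hM' => M'.guarantee_le_of_forall_minorant hm hmv hM'.2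
      fun g l hl => le_many_bidders_value hn hv hM' hmv hs hs2 hns hl)
    (isSecondPriceAuction_secondPriceAuction n vbar 0).mem_exPostMechanisms
    ((isSecondPriceAuction_secondPriceAuction n vbar 0).many_bidders_value_le_guarantee hn hv le_rfl
      (by linarith) m) h.mem_exPostMechanisms]
  refine ⟨fun hg => ?_, fun hrn => h.many_bidders_value_le_guarantee hn hv hr
    (by rwa [le_div_iff₀' hN0] at hrn) m⟩
  obtain ⟨l, hl⟩ := M.exists_affine_minorant h.mem_exPostMechanisms.2 (fun _ => ⟨hm, hmv⟩) hv.le hg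
  have htop := affine_minorant_top_le hv.le h.mem_exPostMechanisms.2 hl
  set p := vbar / n with hp
  have hnp : n * p = vbar := mul_div_cancel₀ _ hN0.ne'
  have hp0 : 0 < p := div_pos hv hN0
  have hsm : vbar - s < m := by nlinarith
  have hpm : p < m := by
    rw [hp, div_lt_iff₀' hN0]
    nlinarith
  set g := (n * m - vbar) / ((n : ℝ) - 1) with hgdef
  have hgp : g * (vbar - p) = vbar * (m - p) := by
    rw [hgdef, hp]
    field_simp
  have hgpos : 0 < g := div_pos (by nlinarith) hN1
  refine h.reserve_le_of_minorant hp0.le hpm hmv.le hl fun t hpt htm => ?_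
  -- were the minorant nonpositive at `(t, …, t)`, its values there and at the highest profile
  -- would force `g ≤ vbar (m - t) / (vbar - t)`, which decreases in `t` and equals `g` at `p`
  by_contra! hle
  have h1 := mul_le_mul_of_nonneg_right hle (by linarith : 0 ≤ vbar - m)
  have h2 := mul_le_mul_of_nonneg_right htop (by linarith : 0 ≤ m - t)
  have h3 : 0 < (vbar - g) * (t - p) := by
    refine mul_pos (sub_pos.2 ?_) (by linarith)
    rw [hgdef, div_lt_iff₀ hN1]
    nlinarith
  nlinarith

end RobustAuction

theorem mainTheorem4 (vbar m : ℝ) (hm : 0 < m) (hmv : m < vbar) :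
    (∀ n : ℕ, 2 ≤ n → ∀ r : ℝ, 0 ≤ r → ∀ M : RobustAuction.Mechanism n vbar,
      RobustAuction.IsSecondPriceAuction M r →
        (M.SolvesMaxmin (fun _ => m) ↔
          (r = vbar - Real.sqrt (vbar * (vbar - m)) ∧
              (n : ℝ) < 1 / (1 - Real.sqrt (1 - m / vbar))) ∨
            (r ∈ Set.Icc 0 (vbar / (n : ℝ)) ∧
              1 / (1 - Real.sqrt (1 - m / vbar)) ≤ (n : ℝ)))) ∧
    (∃ N : ℕ, ∀ n : ℕ, N ≤ n → ∀ M : RobustAuction.Mechanism n vbar,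
      RobustAuction.IsSecondPriceAuction M 0 → M.SolvesMaxmin (fun _ => m)) := by
  have hv : 0 < vbar := hm.trans hmv
  set s := Real.sqrt (vbar * (vbar - m))
  have hpos : 0 < vbar * (vbar - m) := mul_pos hv (sub_pos.2 hmv)
  have hs0 : 0 < s := Real.sqrt_pos.2 hpos
  have hs2 : s ^ 2 = vbar * (vbar - m) := Real.sq_sqrt hpos.le
  have hsv : s < vbar := lt_of_pow_lt_pow_left₀ 2 hv.le (by rw [hs2]; nlinarith)
  have hthr : 1 / (1 - Real.sqrt (1 - m / vbar)) = vbar / (vbar - s) := by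
    have : 1 - m / vbar = (s / vbar) ^ 2 := by
      rw [div_pow, hs2]
      field_simp
    rw [this, Real.sqrt_sq (by positivity)]
    have : vbar - s ≠ 0 := by linarith
    field_simp
  have hsv' : 0 < vbar - s := by linarith
  rw [hthr]
  have main : ∀ n : ℕ, 2 ≤ n → ∀ r : ℝ, 0 ≤ r → ∀ M : RobustAuction.Mechanism n vbar,
      RobustAuction.IsSecondPriceAuction M r → (M.SolvesMaxmin (fun _ => m) ↔
        (r = vbar - s ∧ (n : ℝ) < vbar / (vbar - s)) ∨
          (r ∈ Set.Icc 0 (vbar / (n : ℝ)) ∧ vbar / (vbar - s) ≤ (n : ℝ))) := by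
    intro n hn r hr M h
    rcases lt_or_ge (n : ℝ) (vbar / (vbar - s)) with hlt | hge
    · rw [h.solvesMaxmin_iff_of_few_bidders hn hr hm hmv hs0 hsv hs2 ((lt_div_iff₀ hsv').1 hlt)]
      simp [hlt]
    · rw [h.solvesMaxmin_iff_of_many_bidders hn hr hm hmv hs0 hs2 ((div_le_iff₀ hsv').1 hge)]
      simp [hge, hr]
  refine ⟨main, max 2 ⌈vbar / (vbar - s)⌉₊, fun n hn M h => ?_⟩
  refine (main n ((le_max_left _ _).trans hn) 0 le_rfl M h).2 (Or.inr ⟨⟨le_rfl, ?_⟩, ?_⟩)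
  · positivity
  · exact (Nat.le_ceil _).trans (by exact_mod_cast (le_max_right _ _).trans hn)
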